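/- There is a universal constant $C>0$ such that the following holds. Let $L\ge 0$ be an integer, let $d_1^l,d_2^l$ ($1\le l\le L$) be dimensions, and let $d>0$ and $\Psi>0$ be real numbers. Let $A^1,\dots,A^L$ be random real matrices, $A^l$ of size $d_1^l\times d_2^l$, such that every entry satisfies $A^l_{ij}\sim\mathcal N(0,\Psi)$ (mean $0$, variance $\Psi$) and, for each $l$, the entries of $A^l$ are independent. Let $\hat A^1,\dots,\hat A^L$ be obtained from $A^1,\dots,A^L$ by randomized magnitude-based pruning: conditionally on $(A^1,\dots,A^L)$, independently over all $(l,i,j)$ with $i\neq j$, one sets $\hat A^l_{ij}=0$ with probability $\exp\!\big(-(A^l_{ij})^2/(d\Psi)\big)$ and $\hat A^l_{ij}=A^l_{ij}$ otherwise, while the diagonal entries are kept, $\hat A^l_{ii}=A^l_{ii}$. Then for every layer $l\in\{1,\dots,L\}$ and every real $\epsilon_l>0$, with probability at least $1-\frac1{\epsilon_l}$, $$\|\hat A^l-A^l\|_2\le \epsilon_l\,\Gamma_l,\qquad \Gamma_l=C\left[\sqrt{\frac{d^{3/2}\Psi}{(d+2)^{3/2}}}\left(\sqrt{d_1^l}+\sqrt{d_2^l}\right)+\left(\frac{3\,d_1^l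 d_2^l\, d^{5/2}\Psi^2}{(d+2)^{5/2}}\right)^{1/4}\right],$$ where $\|\cdot\|_2$ denotes the spectral norm (the operator norm with respect to the Euclidean norms). -/

import Mathlib

open MeasureTheory ProbabilityTheory
open scoped NNReal

noncomputable section

/-- The positions `(l, i, j)` of the weights of a model with `L` layers, the `l`-th weight matrix
having `d₁ l` rows and `d₂ l` columns. -/
abbrev Entry {L : ℕ} (d₁ d₂ : Fin L → ℕ) : Type :=
  (l : Fin L) × (Fin (d₁ l) × Fin (d₂ l))

/-- A model: all the weights, with the product `σ`-algebra. -/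
abbrev Model {L : ℕ} (d₁ d₂ : Fin L → ℕ) : Type :=
  Entry d₁ d₂ → ℝ

/-- The weight matrix of layer `l`. -/
def Model.layer {L : ℕ} {d₁ d₂ : Fin L → ℕ} (A : Model d₁ d₂) (l : Fin L) :
    Matrix (Fin (d₁ l)) (Fin (d₂ l)) ℝ :=
  Matrix.of fun i j => A ⟨l, i, j⟩

open scoped Matrix.Norms.L2Operator in
/-- The spectral norm: the operator norm between Euclidean spaces. -/
def spectralNorm₂ {m n : ℕ} (M : Matrix (Fin m) (Fin n) ℝ) : ℝ := ‖M‖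

/-- The probability `exp (-a² / (d Ψ))` with which a weight of value `a` is pruned. -/
def pruneProb (d Ψ : ℝ≥0) (a : ℝ) : unitInterval :=
  ⟨Real.exp (-a ^ 2 / (d * Ψ)), (Real.exp_pos _).le, by
    rw [Real.exp_le_one_iff]
    exact div_nonpos_of_nonpos_of_nonneg (by nlinarith [sq_nonneg a]) (by positivity)⟩

/-- The law of the output of the pruning step at the position `e` when the weight there is `a`:
off the diagonal it is `0` with probability `exp (-a² / (d Ψ))` and `a` otherwise;
on the diagonal the weight is kept. -/
def pruneEntry {L : ℕ} {d₁ d₂ : Fin L → ℕ} (d Ψ : ℝ≥0) (e : Entry d₁ d₂) (a : ℝ) : Measure ℝ :=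
  if (e.2.1 : ℕ) = (e.2.2 : ℕ) then Measure.dirac a
  else bernoulliMeasure 0 a (pruneProb d Ψ a)

instance {L : ℕ} {d₁ d₂ : Fin L → ℕ} (d Ψ : ℝ≥0) (e : Entry d₁ d₂) (a : ℝ) :
    IsProbabilityMeasure (pruneEntry d Ψ e a) := by
  unfold pruneEntry
  split_ifs <;> infer_instance

theorem measurable_pruneEntry {L : ℕ} {d₁ d₂ : Fin L → ℕ} (d Ψ : ℝ≥0) (e : Entry d₁ d₂) :
    Measurable (pruneEntry d Ψ e) := by
  unfold pruneEntry
  split_ifs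
  · exact Measure.measurable_dirac
  · refine Measure.measurable_of_measurable_coe _ fun s hs => ?_
    have h : Measurable (pruneProb d Ψ) := by
      unfold pruneProb
      fun_prop
    have h1 : Measurable fun a : ℝ => unitInterval.toNNReal (pruneProb d Ψ a) := by
      fun_prop
    have h2 : Measurable fun a : ℝ =>
        unitInterval.toNNReal (unitInterval.symm (pruneProb d Ψ a)) := by
      fun_prop
    have h3 : Measurable fun a : ℝ => s.indicator (1 : ℝ → ENNReal) a :=
      measurable_one.indicator hs
    simp only [bernoulliMeasure_def, Measure.add_apply, Measure.smul_apply,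
      Measure.dirac_apply' _ hs, ENNReal.smul_def, smul_eq_mul]
    exact (h1.coe_nnreal_ennreal.mul_const _).add (h2.coe_nnreal_ennreal.mul h3)

/-- Magnitude-based pruning, as a Markov kernel sending a model `A` to the law of the pruned
model: given `A`, the positions are pruned independently of each other. -/
def mbp {L : ℕ} (d₁ d₂ : Fin L → ℕ) (d Ψ : ℝ≥0) : Kernel (Model d₁ d₂) (Model d₁ d₂) where
  toFun A := Measure.pi fun e => pruneEntry d Ψ e (A e)
  measurable' := by
    refine Measurable.measure_of_isPiSystem_of_isProbabilityMeasure generateFrom_pi.symm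
      isPiSystem_pi ?_
    rintro _ ⟨s, hs, rfl⟩
    simp only [Measure.pi_pi]
    refine Finset.measurable_prod _ fun e _ => ?_
    have hse : MeasurableSet (s e) := by simpa using hs e (Set.mem_univ e)
    exact (Measure.measurable_coe hse).comp
      ((measurable_pruneEntry d Ψ e).comp (measurable_pi_apply e))

instance {L : ℕ} (d₁ d₂ : Fin L → ℕ) (d Ψ : ℝ≥0) : IsMarkovKernel (mbp d₁ d₂ d Ψ) :=
  ⟨fun A => inferInstanceAs
    (IsProbabilityMeasure (Measure.pi fun e => pruneEntry d Ψ e (A e)))⟩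

/-- The quantity `Γ` for a layer of size `m × n`. -/
def layerGamma (C d Ψ : ℝ) (m n : ℕ) : ℝ :=
  C * (√(d ^ (3 / 2 : ℝ) * Ψ / (d + 2) ^ (3 / 2 : ℝ)) * (√(m : ℝ) + √(n : ℝ))
    + (3 * m * n * d ^ (5 / 2 : ℝ) * Ψ ^ 2 / (d + 2) ^ (5 / 2 : ℝ)) ^ (1 / 4 : ℝ))

end

/-! The constant is `C = 3`, and Markov's inequality reduces the claim to a bound on the mean
spectral norm of the error `Ahat - A` in one layer. Put `r = d / (d + 2)`. Multiplying the `N(0, Ψ)`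
density by the pruning probability gives `√r` times the `N(0, Ψ r)` density. So the errors in a
layer are independent, zero on the diagonal, and elsewhere nonzero with probability `p = √r`, in
which case they are Gaussian with variance `s = Ψ r`.

The mean norm of such a sparse matrix `X` is bounded without logarithms by a PAC-Bayes argument. A
pair `(x, y)` of vectors in the unit balls is replaced by a Gaussian vector centred at `(x, y)` with
covariance `v I`; its relative entropy to the centred Gaussian is at most `1 / v`, uniformly in `(x,
y)`. Hence the supremum over `(x, y)` of a smoothed bilinear form is controlled by one exponential
moment under the centred Gaussian (`ofReal_le_lintegral_exp_pi_gaussianReal`,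
`ofReal_spectralNorm₂_le`). Subtracting `s l² / 2 * w_i² w_j'²` at each nonzero entry makes the mean
of this moment over `X` at most `1`, by Fubini and independence.

What remains is the smoothed penalty, governed by the largest row and column counts of nonzero
entries and by their total. Second moments bound these. With `τ = √(m n p)`, `T = n p + m p + τ`, `v
= 1 / T` and `s l² = T`, the mean norm is at most `3 √(s T)` (`lintegral_spectralNorm₂_pi_le`).
Subadditivity of the square root turns this into `Γ`. -/

/-- The integral of a product of functions of single coordinates against a product of probability
measures is the product of the integrals. -/
theorem lintegral_pi_prod {ι : Type*} [Fintype ι] {E : ι → Type*} [∀ i, MeasurableSpace (E i)]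
    (μ : ∀ i, Measure (E i)) [∀ i, IsProbabilityMeasure (μ i)] {f : ∀ i, E i → ENNReal}
    (hf : ∀ i, Measurable (f i)) :
    ∫⁻ u, ∏ i, f i (u i) ∂Measure.pi μ = ∏ i, ∫⁻ a, f i a ∂μ i := by
  have h : iIndepFun (fun i (u : ∀ i, E i) => f i (u i)) (Measure.pi μ) :=
    iIndepFun_pi fun i => (hf i).aemeasurable
  rw [lintegral_prod_eq_prod_lintegral_of_indepFun Finset.univ _ h
    fun i => (hf i).comp (measurable_pi_apply i)]
  refine Finset.prod_congr rfl fun i _ => ?_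
  exact (measurePreserving_eval μ i).lintegral_comp (hf i)

theorem withDensity_pi_prod {ι : Type*} [Fintype ι] {E : ι → Type*} [∀ i, MeasurableSpace (E i)]
    (μ : ∀ i, Measure (E i)) [∀ i, IsProbabilityMeasure (μ i)] {f : ∀ i, E i → ENNReal}
    (hf : ∀ i, Measurable (f i)) [∀ i, SigmaFinite ((μ i).withDensity (f i))] :
    (Measure.pi μ).withDensity (fun u => ∏ i, f i (u i)) =
      Measure.pi fun i => (μ i).withDensity (f i) := by
  refine (Measure.pi_eq fun s hs => ?_).symm
  rw [withDensity_apply _ (.univ_pi hs), ← lintegral_indicator (.univ_pi hs)]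
  have h (u : ∀ i, E i) : (Set.univ.pi s).indicator (fun u => ∏ i, f i (u i)) u
      = ∏ i, (s i).indicator (f i) (u i) := by
    classical
    by_cases hu : u ∈ Set.univ.pi s
    · rw [Set.indicator_of_mem hu]
      exact Finset.prod_congr rfl fun i _ => (Set.indicator_of_mem (hu i trivial) _).symm
    · rw [Set.indicator_of_notMem hu]
      simp only [Set.mem_univ_pi, not_forall] at hu
      obtain ⟨i, hi⟩ := hu
      exact (Finset.prod_eq_zero (Finset.mem_univ i) (Set.indicator_of_notMem hi _)).symm
  simp_rw [h]
  rw [lintegral_pi_prod μ fun i => (hf i).indicator (hs i)]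
  refine Finset.prod_congr rfl fun i _ => ?_
  rw [lintegral_indicator (hs i), withDensity_apply _ (hs i)]

/-! ### Gaussian translation and the variational inequality. -/

/-- A Gaussian measure is absolutely continuous with respect to its translates, with an explicit
density. -/
theorem gaussianReal_zero_eq_withDensity (x : ℝ) {v : ℝ≥0} (hv : v ≠ 0) :
    gaussianReal 0 v = (gaussianReal x v).withDensity
      fun u => ENNReal.ofReal (Real.exp (x ^ 2 / (2 * v) - u * x / v)) := by
  have hv' : (v : ℝ) ≠ 0 := by exact_mod_cast hv
  rw [gaussianReal_of_var_ne_zero 0 hv, gaussianReal_of_var_ne_zero x hv,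
    ← withDensity_mul _ (by fun_prop) (by fun_prop)]
  congr 1
  ext u
  simp only [Pi.mul_apply, gaussianPDF, gaussianPDFReal]
  rw [← ENNReal.ofReal_mul (by positivity), mul_assoc _ (Real.exp _), ← Real.exp_add]
  congr 3
  field_simp
  ring

theorem pi_gaussianReal_zero_eq_withDensity {ι : Type*} [Fintype ι] (x : ι → ℝ) {v : ℝ≥0}
    (hv : v ≠ 0) :
    Measure.pi (fun _ : ι => gaussianReal 0 v) =
      (Measure.pi fun i => gaussianReal (x i) v).withDensity
        fun u => ENNReal.ofReal (Real.exp (∑ i, (x i ^ 2 / (2 * v) - u i * x i / v))) := by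
  have h (i : ι) := gaussianReal_zero_eq_withDensity (x i) hv
  have (i : ι) : SigmaFinite ((gaussianReal (x i) v).withDensity
      fun u => ENNReal.ofReal (Real.exp (x i ^ 2 / (2 * v) - u * x i / v))) := by
    rw [← h i]; infer_instance
  have h' := withDensity_pi_prod (fun i => gaussianReal (x i) v)
    (f := fun i u => ENNReal.ofReal (Real.exp (x i ^ 2 / (2 * v) - u * x i / v)))
    (fun i => by fun_prop)
  simp_rw [← h] at h'
  rw [← h']
  congr 1
  ext u
  rw [Real.exp_sum, ENNReal.ofReal_prod_of_nonneg fun i _ => (Real.exp_pos _).le]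

/-- Here `f` may change sign and `g` need not be integrable, so the variational bound also covers
infinite exponential moments. -/
theorem ofReal_integral_le_lintegral_of_le {α : Type*} [MeasurableSpace α] {μ : Measure α}
    {f g : α → ℝ} (hf : Integrable f μ) (hfg : ∀ a, f a ≤ g a) :
    ENNReal.ofReal (∫ a, f a ∂μ) ≤ ∫⁻ a, ENNReal.ofReal (g a) ∂μ := by
  calc ENNReal.ofReal (∫ a, f a ∂μ) ≤ ENNReal.ofReal (∫ a, max (f a) 0 ∂μ) :=
        ENNReal.ofReal_le_ofReal (integral_mono hf hf.pos_part fun a => le_max_left _ _)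
    _ = ∫⁻ a, ENNReal.ofReal (max (f a) 0) ∂μ :=
        ofReal_integral_eq_lintegral_ofReal hf.pos_part (.of_forall fun a => le_max_right _ _)
    _ ≤ _ := by
        refine lintegral_mono fun a => ?_
        rw [ENNReal.ofReal_max, ENNReal.ofReal_zero, max_eq_left zero_le]
        exact ENNReal.ofReal_le_ofReal (hfg a)

/-- A variational lower bound for the exponential moment of `f` under a centred Gaussian measure,
in terms of the mean of `f` under a translate of that measure. -/
theorem ofReal_le_lintegral_exp_pi_gaussianReal {ι : Type*} [Fintype ι] (x : ι → ℝ) {v : ℝ≥0}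
    (hv : v ≠ 0) {f : (ι → ℝ) → ℝ} (hfm : Measurable f)
    (hf : Integrable f (Measure.pi fun i => gaussianReal (x i) v)) :
    ENNReal.ofReal (1 + ∫ u, f u ∂(Measure.pi fun i => gaussianReal (x i) v)
        - ∑ i, x i ^ 2 / (2 * v))
      ≤ ∫⁻ u, ENNReal.ofReal (Real.exp (f u)) ∂(Measure.pi fun _ => gaussianReal 0 v) := by
  have hv' : (v : ℝ) ≠ 0 := by exact_mod_cast hv
  rw [pi_gaussianReal_zero_eq_withDensity x hv,
    lintegral_withDensity_eq_lintegral_mul _ (by fun_prop) (by fun_prop)]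
  simp only [Pi.mul_apply]
  simp_rw [← ENNReal.ofReal_mul (Real.exp_pos _).le, ← Real.exp_add]
  set ρ := Measure.pi fun i => gaussianReal (x i) v with hρ
  have hid (i : ι) : Integrable (fun u : ι → ℝ => u i) ρ :=
    integrable_eval ((memLp_id_gaussianReal 1).integrable (by simp))
  have hterm (i : ι) : Integrable (fun u : ι → ℝ => x i ^ 2 / (2 * v) - u i * x i / v) ρ :=
    (integrable_const _).sub (((hid i).mul_const _).div_const _)
  have hsum : Integrable (fun u : ι → ℝ => ∑ i, (x i ^ 2 / (2 * v) - u i * x i / v)) ρ :=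
    integrable_finsetSum _ fun i _ => hterm i
  -- The mean log-density under the translate is minus the relative entropy.
  have hval : ∫ u, ∑ i, (x i ^ 2 / (2 * v) - u i * x i / v) ∂ρ = - ∑ i, x i ^ 2 / (2 * v) := by
    rw [integral_finsetSum _ fun i _ => hterm i, ← Finset.sum_neg_distrib]
    refine Finset.sum_congr rfl fun i _ => ?_
    rw [integral_sub (integrable_const _) (((hid i).mul_const _).div_const _),
      integral_div (v : ℝ) (fun u : ι → ℝ => u i * x i), integral_mul_const, hρ, integral_eval,
      integral_id_gaussianReal]
    simp only [integral_const, probReal_univ, one_smul]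
    field_simp
    ring
  -- The inequality `1 + t ≤ exp t` replaces Jensen's inequality, so no logarithm of the moment is
  -- taken.
  have h := ofReal_integral_le_lintegral_of_le (μ := ρ)
    (f := fun u => ∑ i, (x i ^ 2 / (2 * v) - u i * x i / v) + f u + 1)
    (g := fun u => Real.exp (∑ i, (x i ^ 2 / (2 * v) - u i * x i / v) + f u))
    ((hsum.add hf).add (integrable_const 1)) fun u => Real.add_one_le_exp _
  have hadd := hsum.add hf
  simp only [Pi.add_def] at hadd
  rw [integral_add hadd (integrable_const 1), integral_add hsum hf, hval] at h
  refine le_trans (le_of_eq ?_) h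
  congr 1
  simp
  ring

/-! ### Moments under Gaussian product measures. -/

theorem integral_sq_gaussianReal (x : ℝ) (v : ℝ≥0) :
    ∫ a, a ^ 2 ∂gaussianReal x v = x ^ 2 + v := by
  have h := variance_eq_sub (memLp_id_gaussianReal (μ := x) (v := v) 2)
  simp only [variance_id_gaussianReal, id_eq, integral_id_gaussianReal, Pi.pow_apply] at h
  linarith

theorem integrable_sq_gaussianReal (x : ℝ) (v : ℝ≥0) :
    Integrable (fun a => a ^ 2) (gaussianReal x v) :=
  (memLp_id_gaussianReal (μ := x) (v := v) 2).integrable_sq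

theorem integrable_id_gaussianReal (x : ℝ) (v : ℝ≥0) :
    Integrable (fun a => a) (gaussianReal x v) :=
  (memLp_id_gaussianReal (μ := x) (v := v) 1).integrable (by simp)

theorem integrable_mul_eval_pi {ι : Type*} [Fintype ι] (μ : ι → Measure ℝ)
    [∀ i, IsProbabilityMeasure (μ i)] {f g : ℝ → ℝ} {i j : ι} (hij : i ≠ j)
    (hf : Integrable f (μ i)) (hg : Integrable g (μ j)) (hfm : Measurable f) (hgm : Measurable g) :
    Integrable (fun u : ι → ℝ => f (u i) * g (u j)) (Measure.pi μ) ∧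
      ∫ u : ι → ℝ, f (u i) * g (u j) ∂Measure.pi μ = (∫ a, f a ∂μ i) * ∫ a, g a ∂μ j := by
  have h : iIndepFun (fun i (u : ι → ℝ) => u i) (Measure.pi μ) :=
    iIndepFun_pi (X := fun _ a => a) fun i => aemeasurable_id
  have h' := (h.indepFun hij).comp hfm hgm
  refine ⟨h'.integrable_mul (integrable_comp_eval hf) (integrable_comp_eval hg), ?_⟩
  have := h'.integral_fun_mul_eq_mul_integral
    (integrable_comp_eval hf).aestronglyMeasurable (integrable_comp_eval hg).aestronglyMeasurable
  simp only [Function.comp_apply] at this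
  rw [this, integral_comp_eval hf.aestronglyMeasurable, integral_comp_eval hg.aestronglyMeasurable]

/-! ### The spectral norm through bilinear forms. -/

open scoped Matrix.Norms.L2Operator in
theorem spectralNorm₂_le_of_bilin_le {m n : ℕ} (M : Matrix (Fin m) (Fin n) ℝ) {c : ℝ} (hc : 0 ≤ c)
    (h : ∀ (x : Fin m → ℝ) (y : Fin n → ℝ), ∑ i, x i ^ 2 ≤ 1 → ∑ j, y j ^ 2 ≤ 1 →
      ∑ e : Fin m × Fin n, M e.1 e.2 * (x e.1 * y e.2) ≤ c) :
    spectralNorm₂ M ≤ c := by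
  unfold spectralNorm₂
  rw [Matrix.l2_opNorm_def]
  refine ContinuousLinearMap.opNorm_le_of_re_inner_le (𝕜 := ℝ) hc fun y x hy hx => ?_
  have hx' : ∑ i, x i ^ 2 ≤ 1 := by
    have := EuclideanSpace.norm_sq_eq x
    simp only [hx, Real.norm_eq_abs, sq_abs] at this
    linarith
  have hy' : ∑ i, y i ^ 2 ≤ 1 := by
    have := EuclideanSpace.norm_sq_eq y
    simp only [hy, Real.norm_eq_abs, sq_abs] at this
    linarith
  refine le_trans (le_of_eq ?_) (h x y hx' hy')
  rw [Fintype.sum_prod_type]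
  simp [PiLp.inner_apply, Matrix.mulVec, dotProduct, Finset.mul_sum]
  refine Finset.sum_congr rfl fun i _ => Finset.sum_congr rfl fun j _ => by ring

open scoped Matrix.Norms.L2Operator in
theorem measurable_spectralNorm₂ {m n : ℕ} :
    Measurable fun X : Fin m × Fin n → ℝ => spectralNorm₂ (Matrix.of fun i j => X (i, j)) := by
  have h : Continuous fun X : Fin m × Fin n → ℝ =>
      (Matrix.of fun i j => X (i, j) : Matrix (Fin m) (Fin n) ℝ) := by
    refine continuous_matrix fun i j => ?_
    simp only [Matrix.of_apply]
    fun_prop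
  exact (continuous_norm.comp h).measurable

theorem spectralNorm₂_nonneg {m n : ℕ} (M : Matrix (Fin m) (Fin n) ℝ) : 0 ≤ spectralNorm₂ M := by
  open scoped Matrix.Norms.L2Operator in exact norm_nonneg M

/-! ### The variational bound for one fixed matrix. -/

/-- The bilinear form of `X`, penalised by `c` times the quadratic form of `b`. -/
def penalizedForm {ι κ : Type*} [Fintype ι] [Fintype κ] (l c : ℝ) (X b : ι × κ → ℝ)
    (w : ι ⊕ κ → ℝ) : ℝ :=
  ∑ e : ι × κ, (l * X e * (w (.inl e.1) * w (.inr e.2))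
    - c * b e * (w (.inl e.1) ^ 2 * w (.inr e.2) ^ 2))

/-- Row and column coordinates are independent, so smoothing leaves the bilinear form unchanged and
only adds `v` to each square in the penalty. -/
theorem integral_penalizedForm {ι κ : Type*} [Fintype ι] [Fintype κ] (l c : ℝ) (X b : ι × κ → ℝ)
    (z : ι ⊕ κ → ℝ) (v : ℝ≥0) :
    Integrable (penalizedForm l c X b) (Measure.pi fun i => gaussianReal (z i) v) ∧
    ∫ w, penalizedForm l c X b w ∂(Measure.pi fun i => gaussianReal (z i) v) =
      ∑ e : ι × κ, (l * X e * (z (.inl e.1) * z (.inr e.2))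
        - c * b e * ((z (.inl e.1) ^ 2 + v) * (z (.inr e.2) ^ 2 + v))) := by
  have h1 (e : ι × κ) := integrable_mul_eval_pi (fun i => gaussianReal (z i) v)
    (i := .inl e.1) (j := .inr e.2) (by simp) (integrable_id_gaussianReal _ _)
    (integrable_id_gaussianReal _ _) measurable_id measurable_id
  have h2 (e : ι × κ) := integrable_mul_eval_pi (fun i => gaussianReal (z i) v)
    (i := .inl e.1) (j := .inr e.2) (f := fun a => a ^ 2) (g := fun a => a ^ 2) (by simp)
    (integrable_sq_gaussianReal _ _)
    (integrable_sq_gaussianReal _ _) (by fun_prop) (by fun_prop)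
  have h3 (e : ι × κ) := ((h1 e).1.const_mul (l * X e)).sub ((h2 e).1.const_mul (c * b e))
  simp only [Pi.sub_def] at h3
  refine ⟨integrable_finsetSum _ fun e _ => h3 e, ?_⟩
  unfold penalizedForm
  rw [integral_finsetSum _ fun e _ => h3 e]
  refine Finset.sum_congr rfl fun e _ => ?_
  rw [integral_sub ((h1 e).1.const_mul (l * X e)) ((h2 e).1.const_mul (c * b e)),
    integral_const_mul, integral_const_mul, (h1 e).2, (h2 e).2]
  simp only [integral_id_gaussianReal, integral_sq_gaussianReal]

theorem measurable_penalizedForm {ι κ : Type*} [Fintype ι] [Fintype κ] (l c : ℝ)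
    (X b : ι × κ → ℝ) : Measurable (penalizedForm l c X b) := by
  unfold penalizedForm
  fun_prop

/-- Expand the product: the leading term uses `b ≤ 1`, the two mixed terms use row and column sums,
and the last one the total. -/
theorem sum_mul_add_mul_add_le {ι κ : Type*} [Fintype ι] [Fintype κ] {b : ι × κ → ℝ}
    (hb1 : ∀ e, b e ≤ 1) {x : ι → ℝ} {y : κ → ℝ} (hx : ∑ i, x i ^ 2 ≤ 1)
    (hy : ∑ j, y j ^ 2 ≤ 1) {v R K : ℝ} (hv : 0 ≤ v) (hR0 : 0 ≤ R) (hK0 : 0 ≤ K)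
    (hR : ∀ i, ∑ j, b (i, j) ≤ R) (hK : ∀ j, ∑ i, b (i, j) ≤ K) :
    ∑ e : ι × κ, b e * ((x e.1 ^ 2 + v) * (y e.2 ^ 2 + v))
      ≤ 1 + v * (R + K) + v ^ 2 * ∑ e, b e := by
  have e1 : ∑ e : ι × κ, b e * ((x e.1 ^ 2 + v) * (y e.2 ^ 2 + v)) =
      ∑ e : ι × κ, b e * (x e.1 ^ 2 * y e.2 ^ 2) + v * ∑ e : ι × κ, b e * x e.1 ^ 2
        + v * ∑ e : ι × κ, b e * y e.2 ^ 2 + v ^ 2 * ∑ e, b e := by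
    simp only [Finset.mul_sum, ← Finset.sum_add_distrib]
    exact Finset.sum_congr rfl fun e _ => by ring
  have e2 : ∑ e : ι × κ, b e * (x e.1 ^ 2 * y e.2 ^ 2) ≤ 1 := by
    calc _ ≤ ∑ e : ι × κ, x e.1 ^ 2 * y e.2 ^ 2 :=
          Finset.sum_le_sum fun e _ => mul_le_of_le_one_left (by positivity) (hb1 e)
      _ = (∑ i, x i ^ 2) * ∑ j, y j ^ 2 := by
          rw [Fintype.sum_prod_type, Finset.sum_mul_sum]
      _ ≤ 1 := mul_le_one₀ hx (Finset.sum_nonneg fun j _ => sq_nonneg _) hy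
  have e3 : ∑ e : ι × κ, b e * x e.1 ^ 2 ≤ R := by
    calc _ = ∑ i, (∑ j, b (i, j)) * x i ^ 2 := by
          rw [Fintype.sum_prod_type]; simp only [Finset.sum_mul]
      _ ≤ ∑ i, R * x i ^ 2 :=
          Finset.sum_le_sum fun i _ => mul_le_mul_of_nonneg_right (hR i) (sq_nonneg _)
      _ = R * ∑ i, x i ^ 2 := by rw [Finset.mul_sum]
      _ ≤ R := mul_le_of_le_one_right hR0 hx
  have e4 : ∑ e : ι × κ, b e * y e.2 ^ 2 ≤ K := by
    calc _ = ∑ j, (∑ i, b (i, j)) * y j ^ 2 := by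
          rw [Fintype.sum_prod_type_right]; simp only [Finset.sum_mul]
      _ ≤ ∑ j, K * y j ^ 2 :=
          Finset.sum_le_sum fun i _ => mul_le_mul_of_nonneg_right (hK i) (sq_nonneg _)
      _ = K * ∑ i, y i ^ 2 := by rw [Finset.mul_sum]
      _ ≤ K := mul_le_of_le_one_right hK0 hy
  rw [e1]
  nlinarith [mul_le_mul_of_nonneg_left e3 hv, mul_le_mul_of_nonneg_left e4 hv]

/-- The spectral norm of a matrix is controlled by a Gaussian exponential moment of its bilinear
form, penalised by the quadratic form of a `[0, 1]`-valued matrix `b`, and by the row and column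
sums of `b`. -/
theorem ofReal_spectralNorm₂_le {m n : ℕ} {l c : ℝ} (hl : 0 < l) (hc : 0 ≤ c)
    {X b : Fin m × Fin n → ℝ} (hb0 : ∀ e, 0 ≤ b e) (hb1 : ∀ e, b e ≤ 1) {v : ℝ≥0} (hv : v ≠ 0)
    {R K : ℝ} (hR0 : 0 ≤ R) (hK0 : 0 ≤ K)
    (hR : ∀ i, ∑ j, b (i, j) ≤ R) (hK : ∀ j, ∑ i, b (i, j) ≤ K) :
    ENNReal.ofReal (l * spectralNorm₂ (Matrix.of fun i j => X (i, j)) + 1) ≤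
      ∫⁻ w, ENNReal.ofReal (Real.exp (penalizedForm l c X b w))
          ∂(Measure.pi fun _ => gaussianReal 0 v)
        + ENNReal.ofReal (1 / v + c * (1 + v * (R + K) + v ^ 2 * ∑ e, b e)) := by
  have hv' : (0 : ℝ) < v := by exact_mod_cast pos_iff_ne_zero.2 hv
  set Z := ∫⁻ w, ENNReal.ofReal (Real.exp (penalizedForm l c X b w))
    ∂(Measure.pi fun _ => gaussianReal 0 v) with hZ
  rcases eq_or_ne Z ⊤ with hZt | hZt
  · simp [hZt]
  have hS : 0 ≤ ∑ e, b e := Finset.sum_nonneg fun e _ => hb0 e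
  set W := 1 / (v : ℝ) + c * (1 + v * (R + K) + v ^ 2 * ∑ e, b e) with hW
  have hW0 : 0 ≤ W := by positivity
  have key (x : Fin m → ℝ) (y : Fin n → ℝ) (hx : ∑ i, x i ^ 2 ≤ 1) (hy : ∑ j, y j ^ 2 ≤ 1) :
      l * ∑ e : Fin m × Fin n, X e * (x e.1 * y e.2) ≤ Z.toReal + W - 1 := by
    have h := ofReal_le_lintegral_exp_pi_gaussianReal (Sum.elim x y) hv
      (measurable_penalizedForm l c X b) (integral_penalizedForm l c X b _ v).1
    rw [(integral_penalizedForm l c X b _ v).2, ← hZ, ENNReal.ofReal_le_iff_le_toReal hZt] at h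
    simp only [Sum.elim_inl, Sum.elim_inr, Finset.sum_sub_distrib, Fintype.sum_sum_type,
      ← Finset.sum_div, mul_assoc, ← Finset.mul_sum] at h
    have h2 := mul_le_mul_of_nonneg_left
      (sum_mul_add_mul_add_le hb1 hx hy hv'.le hR0 hK0 hR hK) hc
    -- The entropy cost: the two squared norms add up to at most `2`.
    have h3 : (∑ i, x i ^ 2 + ∑ j, y j ^ 2) / (2 * (v : ℝ)) ≤ 1 / v := by
      rw [div_le_div_iff₀ (by positivity) hv']
      nlinarith
    linarith
  -- Zero vectors show that the bound is nonnegative, as needed for an operator norm bound.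
  have h0 := key 0 0 (by simp) (by simp)
  simp only [Pi.zero_apply, mul_zero, Finset.sum_const_zero] at h0
  have hN : spectralNorm₂ (Matrix.of fun i j => X (i, j)) ≤ (Z.toReal + W - 1) / l := by
    refine spectralNorm₂_le_of_bilin_le _ (by positivity) fun x y hx hy => ?_
    rw [le_div_iff₀ hl, mul_comm]
    exact key x y hx hy
  rw [le_div_iff₀ hl] at hN
  calc _ ≤ ENNReal.ofReal (Z.toReal + W) := ENNReal.ofReal_le_ofReal (by linarith)
    _ = Z + ENNReal.ofReal W := by
      rw [ENNReal.ofReal_add ENNReal.toReal_nonneg hW0, ENNReal.ofReal_toReal hZt]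

/-! ### Fluctuations of the number of nonzero entries. -/

/-- The indicator function of the nonzero reals. -/
noncomputable def nonzeroInd : ℝ → ℝ := Set.indicator {0}ᶜ 1

theorem measurable_nonzeroInd : Measurable nonzeroInd :=
  measurable_one.indicator (measurableSet_singleton 0).compl

theorem nonzeroInd_nonneg (a : ℝ) : 0 ≤ nonzeroInd a :=
  Set.indicator_nonneg (fun _ _ => zero_le_one) a

theorem nonzeroInd_le_one (a : ℝ) : nonzeroInd a ≤ 1 :=
  Set.indicator_le_self' (fun _ _ => zero_le_one) a

theorem nonzeroInd_sq (a : ℝ) : nonzeroInd a ^ 2 = nonzeroInd a := by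
  unfold nonzeroInd
  by_cases h : a ∈ ({0}ᶜ : Set ℝ) <;> simp [h]

theorem integral_nonzeroInd (μ : Measure ℝ) : ∫ a, nonzeroInd a ∂μ = μ.real {0}ᶜ :=
  integral_indicator_one (measurableSet_singleton 0).compl

theorem memLp_nonzeroInd_comp {Ω : Type*} [MeasurableSpace Ω] {μ : Measure Ω}
    [IsProbabilityMeasure μ] {f : Ω → ℝ} (hf : Measurable f) (p : ENNReal) :
    MemLp (fun ω => nonzeroInd (f ω)) p μ :=
  .of_bound (measurable_nonzeroInd.comp hf).aestronglyMeasurable 1 <| .of_forall fun ω => by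
    rw [Real.norm_of_nonneg (nonzeroInd_nonneg _)]
    exact nonzeroInd_le_one _

/-- The variance of the number of nonzero coordinates among the `g j` is at most the number
of these coordinates times `p` if each coordinate is nonzero with probability at most `p`. -/
theorem integral_sq_sum_nonzeroInd_sub_le {ι κ : Type*} [Fintype ι] [Fintype κ] (ν : ι → Measure ℝ)
    [∀ e, IsProbabilityMeasure (ν e)] {p : ℝ} (hp : ∀ e, (ν e).real {0}ᶜ ≤ p) {g : κ → ι}
    (hg : Function.Injective g) :
    Integrable (fun X : ι → ℝ => (∑ j, (nonzeroInd (X (g j)) - (ν (g j)).real {0}ᶜ)) ^ 2)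
      (Measure.pi ν) ∧
    ∫ X, (∑ j, (nonzeroInd (X (g j)) - (ν (g j)).real {0}ᶜ)) ^ 2 ∂Measure.pi ν
      ≤ Fintype.card κ * p := by
  have hL (j : κ) : MemLp (fun X : ι → ℝ => nonzeroInd (X (g j))) 2 (Measure.pi ν) :=
    memLp_nonzeroInd_comp (measurable_pi_apply _) 2
  have hE (j : κ) : ∫ X : ι → ℝ, nonzeroInd (X (g j)) ∂Measure.pi ν = (ν (g j)).real {0}ᶜ := by
    rw [integral_comp_eval measurable_nonzeroInd.aestronglyMeasurable, integral_nonzeroInd]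
  refine ⟨(memLp_finsetSum _ fun j _ => (hL j).sub (memLp_const _)).integrable_sq, ?_⟩
  have hind : iIndepFun (fun i (X : ι → ℝ) => nonzeroInd (X i)) (Measure.pi ν) :=
    iIndepFun_pi (X := fun _ => nonzeroInd) fun i => measurable_nonzeroInd.aemeasurable
  have hvar := IndepFun.variance_sum (μ := Measure.pi ν) (s := Finset.univ)
    (X := fun (j : κ) (X : ι → ℝ) => nonzeroInd (X (g j))) (fun j _ => hL j)
    fun j _ k _ hjk => hind.indepFun (hg.ne hjk)
  rw [variance_eq_integral (Finset.aemeasurable_sum _ fun j _ => (hL j).aemeasurable)] at hvar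
  have hmean : ∫ X : ι → ℝ, (∑ j, fun X : ι → ℝ => nonzeroInd (X (g j))) X ∂Measure.pi ν
      = ∑ j, (ν (g j)).real {0}ᶜ := by
    simp only [Finset.sum_apply]
    rw [integral_finsetSum _ fun j _ => (hL j).integrable (by norm_num)]
    simp_rw [hE]
  rw [hmean] at hvar
  simp only [Finset.sum_apply] at hvar
  simp only [Finset.sum_sub_distrib]
  rw [hvar]
  -- Each variance is at most the second moment, which for an indicator is its mean.
  calc _ ≤ ∑ _j : κ, p := by
        refine Finset.sum_le_sum fun j _ => ?_
        refine (variance_le_expectation_sq (hL j).aestronglyMeasurable).trans ?_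
        simp only [Pi.pow_apply, nonzeroInd_sq]
        rw [hE]
        exact hp _
    _ = _ := by simp

/-! ### Mean spectral norm of a sparse sub-Gaussian matrix. -/

/-- The penalised exponential moment of a random matrix with independent entries. -/
theorem lintegral_lintegral_exp_penalizedForm_le_one {ι κ : Type*} [Fintype ι] [Fintype κ]
    (ν : ι × κ → Measure ℝ) [∀ e, IsProbabilityMeasure (ν e)] {s l : ℝ}
    (hν : ∀ e t, ∫⁻ a, ENNReal.ofReal (Real.exp (t * a - s * t ^ 2 / 2 * nonzeroInd a)) ∂ν e ≤ 1)
    (π : Measure (ι ⊕ κ → ℝ)) [IsProbabilityMeasure π] :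
    Measurable (fun X : ι × κ → ℝ => ∫⁻ w, ENNReal.ofReal (Real.exp (penalizedForm l
      (s * l ^ 2 / 2) X (fun e => nonzeroInd (X e)) w)) ∂π) ∧
    ∫⁻ X, ∫⁻ w, ENNReal.ofReal (Real.exp (penalizedForm l (s * l ^ 2 / 2) X
      (fun e => nonzeroInd (X e)) w)) ∂π ∂Measure.pi ν ≤ 1 := by
  have hm : Measurable fun q : (ι × κ → ℝ) × (ι ⊕ κ → ℝ) => ENNReal.ofReal (Real.exp
      (penalizedForm l (s * l ^ 2 / 2) q.1 (fun e => nonzeroInd (q.1 e)) q.2)) := by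
    have := measurable_nonzeroInd
    unfold penalizedForm
    fun_prop
  refine ⟨hm.lintegral_prod_right', ?_⟩
  -- For fixed `w` the exponential factors over the entries, and `hν` applies to each with `t = l *
  -- w_i * w_j'`.
  rw [lintegral_lintegral_swap hm.aemeasurable]
  calc _ ≤ ∫⁻ _w : ι ⊕ κ → ℝ, 1 ∂π := by
        refine lintegral_mono fun w => ?_
        have h (X : ι × κ → ℝ) : ENNReal.ofReal (Real.exp (penalizedForm l (s * l ^ 2 / 2) X
            (fun e => nonzeroInd (X e)) w)) = ∏ e : ι × κ, ENNReal.ofReal (Real.exp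
              (l * (w (.inl e.1) * w (.inr e.2)) * X e
                - s * (l * (w (.inl e.1) * w (.inr e.2))) ^ 2 / 2 * nonzeroInd (X e))) := by
          unfold penalizedForm
          rw [Real.exp_sum, ENNReal.ofReal_prod_of_nonneg fun i _ => (Real.exp_pos _).le]
          refine Finset.prod_congr rfl fun e _ => ?_
          congr 2
          ring
        simp_rw [h]
        have := measurable_nonzeroInd
        rw [lintegral_pi_prod ν (f := fun e a => ENNReal.ofReal (Real.exp
              (l * (w (.inl e.1) * w (.inr e.2)) * a
                - s * (l * (w (.inl e.1) * w (.inr e.2))) ^ 2 / 2 * nonzeroInd a)))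
                (fun e => by fun_prop)]
        exact Finset.prod_le_one' fun e _ => hν e _
    _ = 1 := by simp

/-- A bound without logarithmic factors for the mean spectral norm of a random matrix whose entries
are independent, are nonzero with probability at most `p`, and are sub-Gaussian with variance
proxy `s` when nonzero. -/
theorem lintegral_spectralNorm₂_pi_le {m n : ℕ} (hm : 0 < m) (hn : 0 < n)
    (ν : Fin m × Fin n → Measure ℝ) [∀ e, IsProbabilityMeasure (ν e)] {s p : ℝ} (hs : 0 < s)
    (hp : 0 < p)
    (hν : ∀ e t, ∫⁻ a, ENNReal.ofReal (Real.exp (t * a - s * t ^ 2 / 2 * nonzeroInd a)) ∂ν e ≤ 1)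
    (hνp : ∀ e, (ν e).real {0}ᶜ ≤ p) :
    ∫⁻ X, ENNReal.ofReal (spectralNorm₂ (Matrix.of fun i j => X (i, j))) ∂Measure.pi ν
      ≤ ENNReal.ofReal (3 * √(s * (n * p + m * p + √(m * n * p)))) := by
  have hm' : (0 : ℝ) < m := by exact_mod_cast hm
  have hn' : (0 : ℝ) < n := by exact_mod_cast hn
  -- `τ²` bounds the mean total of squared deviations over all rows, the same over all columns, and
  -- the mean number of nonzero entries.
  set τ : ℝ := √(m * n * p) with hτ
  have hτ0 : 0 < τ := Real.sqrt_pos.2 (by positivity)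
  have hτ2 : τ ^ 2 = m * n * p := Real.sq_sqrt (by positivity)
  set T : ℝ := n * p + m * p + τ with hT
  have hT0 : 0 < T := by positivity
  -- With this `l` and `v = 1 / T`, the entropy cost and the penalty are both of order `T`.
  set l : ℝ := √(T / s) with hl
  have hl0 : 0 < l := Real.sqrt_pos.2 (by positivity)
  have hl2 : s * l ^ 2 = T := by
    rw [hl, Real.sq_sqrt (by positivity)]
    field_simp
  set v : ℝ≥0 := ⟨T⁻¹, by positivity⟩ with hv
  have hvT : (v : ℝ) = T⁻¹ := rfl
  have hv0 : v ≠ 0 := by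
    intro h
    have : (v : ℝ) = 0 := by rw [h]; rfl
    rw [hvT] at this
    exact (inv_pos.2 hT0).ne' this
  set U : Fin m → (Fin m × Fin n → ℝ) → ℝ := fun i X =>
    (∑ j, (nonzeroInd (X (i, j)) - (ν (i, j)).real {0}ᶜ)) ^ 2 with hU
  set V : Fin n → (Fin m × Fin n → ℝ) → ℝ := fun j X =>
    (∑ i, (nonzeroInd (X (i, j)) - (ν (i, j)).real {0}ᶜ)) ^ 2 with hV
  have hUi (i : Fin m) : Integrable (U i) (Measure.pi ν) ∧ ∫ X, U i X ∂Measure.pi ν ≤ n * p := by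
    simpa only [Fintype.card_fin] using
      integral_sq_sum_nonzeroInd_sub_le ν hνp (g := fun j => (i, j)) (Prod.mk_right_injective i)
  have hVi (j : Fin n) : Integrable (V j) (Measure.pi ν) ∧ ∫ X, V j X ∂Measure.pi ν ≤ m * p := by
    simpa only [Fintype.card_fin] using
      integral_sq_sum_nonzeroInd_sub_le ν hνp (g := fun i => (i, j)) (Prod.mk_left_injective j)
  have hbe (e : Fin m × Fin n) :
      Integrable (fun X : Fin m × Fin n → ℝ => nonzeroInd (X e)) (Measure.pi ν) ∧
      ∫ X, nonzeroInd (X e) ∂Measure.pi ν ≤ p :=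
    ⟨(memLp_nonzeroInd_comp (measurable_pi_apply _) 1).integrable (by simp), by
      rw [integral_comp_eval measurable_nonzeroInd.aestronglyMeasurable, integral_nonzeroInd]
      exact hνp e⟩
  -- The entropy cost plus the penalty, with the largest row and column sums replaced by upper
  -- bounds that are affine in quantities of known mean.
  set W : (Fin m × Fin n → ℝ) → ℝ := fun X => T + T / 2 * (1 + T⁻¹ *
    ((n * p + (τ / 2 + (∑ i, U i X) / (2 * τ))) + (m * p + (τ / 2 + (∑ j, V j X) / (2 * τ))))
      + T⁻¹ ^ 2 * ∑ e, nonzeroInd (X e)) with hW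
  -- Linearising a deviation at scale `τ` lets the largest one be bounded by the sum of all squares,
  -- at a mean cost of `τ`.
  have hdev (a : ℝ) : a ≤ τ / 2 + a ^ 2 / (2 * τ) := by
    rw [div_add_div _ _ two_ne_zero (by positivity), le_div_iff₀ (by positivity)]
    nlinarith [sq_nonneg (a - τ)]
  have hU0 (i X) : 0 ≤ U i X := sq_nonneg _
  have hV0 (j X) : 0 ≤ V j X := sq_nonneg _
  have hrow (X : Fin m × Fin n → ℝ) (i : Fin m) : ∑ j, nonzeroInd (X (i, j))
      ≤ n * p + (τ / 2 + (∑ i, U i X) / (2 * τ)) := by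
    have h1 := hdev (∑ j, (nonzeroInd (X (i, j)) - (ν (i, j)).real {0}ᶜ))
    have h2 : U i X ≤ ∑ i, U i X :=
      Finset.single_le_sum (f := fun i => U i X) (fun i _ => hU0 i X) (Finset.mem_univ i)
    have h3 : ∑ j, (ν (i, j)).real {0}ᶜ ≤ n * p :=
      (Finset.sum_le_sum fun j _ => hνp (i, j)).trans (by simp)
    have h4 : U i X / (2 * τ) ≤ (∑ i, U i X) / (2 * τ) := by gcongr
    rw [Finset.sum_sub_distrib] at h1
    simp only [hU, Finset.sum_sub_distrib] at h4 ⊢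
    linarith
  have hcol (X : Fin m × Fin n → ℝ) (j : Fin n) : ∑ i, nonzeroInd (X (i, j))
      ≤ m * p + (τ / 2 + (∑ j, V j X) / (2 * τ)) := by
    have h1 := hdev (∑ i, (nonzeroInd (X (i, j)) - (ν (i, j)).real {0}ᶜ))
    have h2 : V j X ≤ ∑ j, V j X :=
      Finset.single_le_sum (f := fun j => V j X) (fun j _ => hV0 j X) (Finset.mem_univ j)
    have h3 : ∑ i, (ν (i, j)).real {0}ᶜ ≤ m * p :=
      (Finset.sum_le_sum fun i _ => hνp (i, j)).trans (by simp)
    have h4 : V j X / (2 * τ) ≤ (∑ j, V j X) / (2 * τ) := by gcongr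
    rw [Finset.sum_sub_distrib] at h1
    simp only [hV, Finset.sum_sub_distrib] at h4 ⊢
    linarith
  have hUs (X) : 0 ≤ ∑ i, U i X := Finset.sum_nonneg fun i _ => hU0 i X
  have hVs (X) : 0 ≤ ∑ j, V j X := Finset.sum_nonneg fun j _ => hV0 j X
  have hSs (X : Fin m × Fin n → ℝ) : 0 ≤ ∑ e, nonzeroInd (X e) :=
    Finset.sum_nonneg fun e _ => nonzeroInd_nonneg _
  have hW0 (X) : 0 ≤ W X := by
    have := hUs X
    have := hVs X
    have := hSs X
    simp only [hW]
    positivity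
  have hUI : Integrable (fun X => ∑ i, U i X) (Measure.pi ν) :=
    integrable_finsetSum _ fun i _ => (hUi i).1
  have hVI : Integrable (fun X => ∑ j, V j X) (Measure.pi ν) :=
    integrable_finsetSum _ fun j _ => (hVi j).1
  have hSI : Integrable (fun X : Fin m × Fin n → ℝ => ∑ e, nonzeroInd (X e)) (Measure.pi ν) :=
    integrable_finsetSum _ fun e _ => (hbe e).1
  have hUE : ∫ X, ∑ i, U i X ∂Measure.pi ν ≤ τ ^ 2 := by
    rw [integral_finsetSum _ fun i _ => (hUi i).1, hτ2]
    exact (Finset.sum_le_sum fun i _ => (hUi i).2).trans (by simp [mul_assoc])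
  have hVE : ∫ X, ∑ j, V j X ∂Measure.pi ν ≤ τ ^ 2 := by
    rw [integral_finsetSum _ fun j _ => (hVi j).1, hτ2]
    exact (Finset.sum_le_sum fun i _ => (hVi i).2).trans (by
      simp only [Finset.sum_const, Finset.card_univ, Fintype.card_fin, nsmul_eq_mul]
      exact le_of_eq (by ring))
  have hSE : ∫ X : Fin m × Fin n → ℝ, ∑ e, nonzeroInd (X e) ∂Measure.pi ν ≤ τ ^ 2 := by
    rw [integral_finsetSum _ fun e _ => (hbe e).1, hτ2]
    exact (Finset.sum_le_sum fun e _ => (hbe e).2).trans (by simp)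
  have hWlin (X) : W X = (T + T / 2 + (n * p + m * p + τ) / 2) + ((4 * τ)⁻¹ * (∑ i, U i X)
      + ((4 * τ)⁻¹ * (∑ j, V j X) + (2 * T)⁻¹ * ∑ e, nonzeroInd (X e))) := by
    simp only [hW]
    field_simp
    ring
  have hWI' := (hUI.const_mul (4 * τ)⁻¹).add
    ((hVI.const_mul (4 * τ)⁻¹).add (hSI.const_mul (2 * T)⁻¹))
  have hVS' := (hVI.const_mul (4 * τ)⁻¹).add (hSI.const_mul (2 * T)⁻¹)
  simp only [Pi.add_def] at hWI' hVS'
  have hWI : Integrable W (Measure.pi ν) := by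
    rw [funext hWlin]
    exact (integrable_const _).add hWI'
  -- The constant part is `2 T`, the deviations add at most `τ / 2 ≤ T / 2`, and the total count
  -- adds at most `T / 2`.
  have hWE : ∫ X, W X ∂Measure.pi ν ≤ 3 * T := by
    simp_rw [hWlin]
    rw [integral_add (integrable_const _) hWI', integral_add (hUI.const_mul _) hVS',
      integral_add (hVI.const_mul _) (hSI.const_mul _), integral_const_mul, integral_const_mul,
      integral_const_mul]
    simp only [integral_const, probReal_univ, one_smul]
    have a1 : (4 * τ)⁻¹ * ∫ X, ∑ i, U i X ∂Measure.pi ν ≤ τ / 4 :=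
      (mul_le_mul_of_nonneg_left hUE (by positivity)).trans (le_of_eq (by field_simp))
    have a2 : (4 * τ)⁻¹ * ∫ X, ∑ j, V j X ∂Measure.pi ν ≤ τ / 4 :=
      (mul_le_mul_of_nonneg_left hVE (by positivity)).trans (le_of_eq (by field_simp))
    have hτT : τ ≤ T := by
      have : 0 ≤ n * p + m * p := by positivity
      linarith
    have a3 : (2 * T)⁻¹ * ∫ X : Fin m × Fin n → ℝ, ∑ e, nonzeroInd (X e) ∂Measure.pi ν
        ≤ T / 2 := by
      refine (mul_le_mul_of_nonneg_left (hSE.trans (pow_le_pow_left₀ hτ0.le hτT 2))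
        (by positivity)).trans (le_of_eq (by field_simp))
    linarith
  set π := Measure.pi fun _ : Fin m ⊕ Fin n => gaussianReal 0 v with hπ
  obtain ⟨hZm, hZ⟩ := lintegral_lintegral_exp_penalizedForm_le_one ν (l := l) hν π
  have hpt (X : Fin m × Fin n → ℝ) :
      ENNReal.ofReal (l * spectralNorm₂ (Matrix.of fun i j => X (i, j)) + 1) ≤
      ∫⁻ w, ENNReal.ofReal (Real.exp (penalizedForm l (s * l ^ 2 / 2) X
        (fun e => nonzeroInd (X e)) w)) ∂π + ENNReal.ofReal (W X) := by
    have hU' := hUs X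
    have hV' := hVs X
    have h := ofReal_spectralNorm₂_le (X := X) hl0 (by positivity : 0 ≤ s * l ^ 2 / 2)
      (fun e => nonzeroInd_nonneg (X e)) (fun e => nonzeroInd_le_one (X e)) hv0
      (by positivity) (by positivity) (hrow X) (hcol X)
    refine h.trans (le_of_eq ?_)
    congr 2
    rw [hl2, hvT, one_div, inv_inv]
  -- The `1` on the left comes from `1 + t ≤ exp t`; it cancels the exponential moment, whose mean
  -- is at most `1`.
  have hmain : ∫⁻ X, ENNReal.ofReal (l * spectralNorm₂ (Matrix.of fun i j => X (i, j)))
      ∂Measure.pi ν + 1 ≤ ENNReal.ofReal (3 * T) + 1 := by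
    calc _ = ∫⁻ X, ENNReal.ofReal (l * spectralNorm₂ (Matrix.of fun i j => X (i, j)) + 1)
          ∂Measure.pi ν := by
          have (X : Fin m × Fin n → ℝ) :
              ENNReal.ofReal (l * spectralNorm₂ (Matrix.of fun i j => X (i, j)) + 1) =
              ENNReal.ofReal (l * spectralNorm₂ (Matrix.of fun i j => X (i, j))) + 1 := by
            rw [ENNReal.ofReal_add (mul_nonneg hl0.le (spectralNorm₂_nonneg _)) zero_le_one,
              ENNReal.ofReal_one]
          simp_rw [this]
          rw [lintegral_add_right _ measurable_const]
          simp
      _ ≤ _ := lintegral_mono hpt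
      _ = _ := lintegral_add_left hZm _
      _ ≤ 1 + ENNReal.ofReal (3 * T) := by
          gcongr
          rw [← ofReal_integral_eq_lintegral_ofReal hWI (.of_forall hW0)]
          exact ENNReal.ofReal_le_ofReal hWE
      _ = _ := add_comm _ _
  have hcancel := (ENNReal.add_le_add_iff_right ENNReal.one_ne_top).1 hmain
  simp_rw [ENNReal.ofReal_mul hl0.le] at hcancel
  rw [lintegral_const_mul _ measurable_spectralNorm₂.ennreal_ofReal] at hcancel
  have hfin : 3 * T = l * (3 * √(s * T)) := by
    have : l * √(s * T) = T := by
      rw [hl, ← Real.sqrt_mul (by positivity), show T / s * (s * T) = T ^ 2 by field_simp,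
        Real.sqrt_sq hT0.le]
    linarith
  rw [hfin, ENNReal.ofReal_mul hl0.le] at hcancel
  exact (ENNReal.mul_le_mul_iff_right (by simpa using hl0) ENNReal.ofReal_ne_top).1 hcancel

/-! ### The joint law of the pruning errors in a layer. -/

/-- The pruning step at the position `e`, as a Markov kernel. -/
noncomputable def pruneKernel {L : ℕ} {d₁ d₂ : Fin L → ℕ} (d Ψ : ℝ≥0) (e : Entry d₁ d₂) :
    Kernel ℝ ℝ where
  toFun := pruneEntry d Ψ e
  measurable' := measurable_pruneEntry d Ψ e

instance {L : ℕ} {d₁ d₂ : Fin L → ℕ} (d Ψ : ℝ≥0) (e : Entry d₁ d₂) :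
    IsMarkovKernel (pruneKernel d Ψ e) :=
  ⟨fun a => inferInstanceAs (IsProbabilityMeasure (pruneEntry d Ψ e a))⟩

/-- The law of the change made by pruning to a Gaussian weight at the position `e`. -/
noncomputable def pruneErrorLaw {L : ℕ} {d₁ d₂ : Fin L → ℕ} (d Ψ : ℝ≥0) (e : Entry d₁ d₂) :
    Measure ℝ :=
  ((gaussianReal 0 Ψ) ⊗ₘ pruneKernel d Ψ e).map fun q => q.2 - q.1

instance {L : ℕ} {d₁ d₂ : Fin L → ℕ} (d Ψ : ℝ≥0) (e : Entry d₁ d₂) :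
    IsProbabilityMeasure (pruneErrorLaw d Ψ e) :=
  Measure.isProbabilityMeasure_map (by fun_prop)

theorem pruneErrorLaw_apply {L : ℕ} {d₁ d₂ : Fin L → ℕ} (d Ψ : ℝ≥0) (e : Entry d₁ d₂) {s : Set ℝ}
    (hs : MeasurableSet s) :
    pruneErrorLaw d Ψ e s = ∫⁻ a, pruneEntry d Ψ e a {b | b - a ∈ s} ∂gaussianReal 0 Ψ := by
  have hm : Measurable fun q : ℝ × ℝ => q.2 - q.1 := by fun_prop
  rw [pruneErrorLaw, Measure.map_apply hm hs, Measure.compProd_apply (hm hs)]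
  rfl

theorem lintegral_pruneErrorLaw {L : ℕ} {d₁ d₂ : Fin L → ℕ} (d Ψ : ℝ≥0) (e : Entry d₁ d₂)
    {h : ℝ → ENNReal} (hh : Measurable h) :
    ∫⁻ x, h x ∂pruneErrorLaw d Ψ e =
      ∫⁻ a, ∫⁻ b, h (b - a) ∂pruneEntry d Ψ e a ∂gaussianReal 0 Ψ := by
  rw [pruneErrorLaw, lintegral_map hh (by fun_prop), Measure.lintegral_compProd (by fun_prop)]
  rfl

/-- The entrywise errors made by pruning in a layer are independent. -/
theorem hasLaw_layer_sub {L : ℕ} {d₁ d₂ : Fin L → ℕ} {d Ψ : ℝ≥0} {Ω : Type*} [MeasurableSpace Ω]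
    {P : Measure Ω} [IsProbabilityMeasure P] {A Ahat : Ω → Model d₁ d₂}
    (hA : ∀ e, HasLaw (fun ω => A ω e) (gaussianReal 0 Ψ) P) (l : Fin L)
    (hind : iIndepFun (fun (p : Fin (d₁ l) × Fin (d₂ l)) ω => A ω ⟨l, p⟩) P)
    (hJ : HasLaw (fun ω => (A ω, Ahat ω)) ((P.map A).compProd (mbp d₁ d₂ d Ψ)) P) :
    HasLaw (fun ω (p : Fin (d₁ l) × Fin (d₂ l)) => Ahat ω ⟨l, p⟩ - A ω ⟨l, p⟩)
      (Measure.pi fun p => pruneErrorLaw d Ψ (⟨l, p⟩ : Entry d₁ d₂)) P := by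
  have hAm : AEMeasurable A P := hJ.aemeasurable.fst
  have : IsProbabilityMeasure (P.map A) := Measure.isProbabilityMeasure_map hAm
  set D : Model d₁ d₂ × Model d₁ d₂ → Fin (d₁ l) × Fin (d₂ l) → ℝ :=
    fun q p => q.2 ⟨l, p⟩ - q.1 ⟨l, p⟩ with hD
  have hDm : Measurable D := by fun_prop
  refine HasLaw.comp (Y := D) ⟨hDm.aemeasurable, ?_⟩ hJ
  refine (Measure.pi_eq fun s hs => ?_).symm
  rw [Measure.map_apply hDm (.univ_pi hs), Measure.compProd_apply (hDm (.univ_pi hs))]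
  have hk (p : Fin (d₁ l) × Fin (d₂ l)) : Measurable fun a : ℝ =>
      pruneEntry d Ψ (⟨l, p⟩ : Entry d₁ d₂) a {b | b - a ∈ s p} :=
    Kernel.measurable_kernel_prodMk_left (κ := pruneKernel d Ψ (⟨l, p⟩ : Entry d₁ d₂))
      (t := {q : ℝ × ℝ | q.2 - q.1 ∈ s p})
      ((by fun_prop : Measurable fun q : ℝ × ℝ => q.2 - q.1) (hs p))
  -- Given the weights, the prunings are independent; positions outside layer `l` play no role in
  -- the event.
  have hbox (a : Model d₁ d₂) :
      mbp d₁ d₂ d Ψ a (Prod.mk a ⁻¹' (D ⁻¹' Set.univ.pi s)) =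
        ∏ p, pruneEntry d Ψ (⟨l, p⟩ : Entry d₁ d₂) (a ⟨l, p⟩) {b | b - a ⟨l, p⟩ ∈ s p} := by
    set μ := fun e : Entry d₁ d₂ => pruneEntry d Ψ e (a e) with hμ
    have hi : iIndepFun (fun e (u : Model d₁ d₂) => u e) (Measure.pi μ) :=
      iIndepFun_pi (X := fun _ b => b) fun e => aemeasurable_id
    have hi' := hi.precomp (g := fun p : Fin (d₁ l) × Fin (d₂ l) => (⟨l, p⟩ : Entry d₁ d₂))
      fun p q hpq => by simpa using hpq
    have hS (p : Fin (d₁ l) × Fin (d₂ l)) : MeasurableSet {b | b - a ⟨l, p⟩ ∈ s p} :=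
      (by fun_prop : Measurable fun b : ℝ => b - a ⟨l, p⟩) (hs p)
    have h := hi'.measure_inter_preimage_eq_mul Finset.univ
      (sets := fun p => {b | b - a ⟨l, p⟩ ∈ s p}) fun p _ => hS p
    have hset : Prod.mk a ⁻¹' (D ⁻¹' Set.univ.pi s) = ⋂ p ∈ Finset.univ,
        (fun u : Model d₁ d₂ => u ⟨l, p⟩) ⁻¹' {b | b - a ⟨l, p⟩ ∈ s p} := by
      ext u
      simp [hD]
    change Measure.pi μ _ = _
    rw [hset]
    refine h.trans (Finset.prod_congr rfl fun p _ => ?_)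
    exact (measurePreserving_eval μ ⟨l, p⟩).measure_preimage (hS p).nullMeasurableSet
  simp_rw [hbox]
  have hkA : Measurable fun a : Model d₁ d₂ => ∏ p,
      pruneEntry d Ψ (⟨l, p⟩ : Entry d₁ d₂) (a ⟨l, p⟩) {b | b - a ⟨l, p⟩ ∈ s p} :=
    Finset.measurable_prod _ fun p _ => (hk p).comp (measurable_pi_apply _)
  rw [lintegral_map' hkA.aemeasurable hAm]
  -- Only the joint law of the weights of layer `l` enters, so independence within the layer
  -- suffices.
  have hlaw := hind.hasLaw_pi fun p => hA ⟨l, p⟩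
  have h := hlaw.lintegral_comp (f := fun u => ∏ p,
    pruneEntry d Ψ (⟨l, p⟩ : Entry d₁ d₂) (u p) {b | b - u p ∈ s p})
    (Measurable.aemeasurable (Finset.measurable_prod _ fun p _ =>
      (hk p).comp (measurable_pi_apply _)))
  refine h.trans ?_
  rw [lintegral_pi_prod _ hk]
  exact Finset.prod_congr rfl fun p _ => (pruneErrorLaw_apply d Ψ _ (hs p)).symm

/-! ### The law of a single pruning error. -/

/-- Weighting a centred Gaussian measure by the pruning probability gives a multiple of another
centred Gaussian measure. -/
theorem gaussianReal_withDensity_pruneProb {d Ψ : ℝ≥0} (hd : 0 < d) (hΨ : 0 < Ψ) :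
    (gaussianReal 0 Ψ).withDensity (fun a => ENNReal.ofReal (pruneProb d Ψ a)) =
      ENNReal.ofReal (√(d / (d + 2))) • gaussianReal 0 (Ψ * (d / (d + 2))) := by
  have hd' : (0 : ℝ) < d := by exact_mod_cast hd
  have hΨ' : (0 : ℝ) < Ψ := by exact_mod_cast hΨ
  have hσ : Ψ * (d / (d + 2)) ≠ 0 := by positivity
  have hmp : Measurable fun a => ENNReal.ofReal (pruneProb d Ψ a) := by
    unfold pruneProb
    fun_prop
  rw [gaussianReal_of_var_ne_zero 0 hΨ.ne', gaussianReal_of_var_ne_zero 0 hσ,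
    ← withDensity_mul _ (by fun_prop) hmp, ← withDensity_smul _ (by fun_prop)]
  congr 1
  ext a
  simp only [Pi.mul_apply, Pi.smul_apply, smul_eq_mul, gaussianPDF, gaussianPDFReal, pruneProb]
  rw [← ENNReal.ofReal_mul (by positivity), ← ENNReal.ofReal_mul (by positivity)]
  congr 1
  push_cast
  rw [mul_assoc, ← Real.exp_add, ← mul_assoc]
  congr 1
  · rw [← mul_assoc (2 * Real.pi), Real.sqrt_mul (by positivity : 0 ≤ 2 * Real.pi * (Ψ : ℝ))]
    have : √((d : ℝ) / (d + 2)) ≠ 0 := (Real.sqrt_pos.2 (by positivity)).ne'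
    field_simp
  · congr 1
    field_simp
    ring

theorem lintegral_pruneProb_mul {d Ψ : ℝ≥0} (hd : 0 < d) (hΨ : 0 < Ψ) {g : ℝ → ENNReal}
    (hg : Measurable g) :
    ∫⁻ a, ENNReal.ofReal (pruneProb d Ψ a) * g a ∂gaussianReal 0 Ψ =
      ENNReal.ofReal (√(d / (d + 2))) * ∫⁻ a, g a ∂gaussianReal 0 (Ψ * (d / (d + 2))) := by
  have hmp : Measurable fun a => ENNReal.ofReal (pruneProb d Ψ a) := by
    unfold pruneProb
    fun_prop
  have h := lintegral_withDensity_eq_lintegral_mul (gaussianReal 0 Ψ) hmp hg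
  rw [gaussianReal_withDensity_pruneProb hd hΨ, lintegral_smul_measure] at h
  exact h.symm

theorem lintegral_exp_gaussianReal_eq_one (t : ℝ) (v : ℝ≥0) :
    ∫⁻ a, ENNReal.ofReal (Real.exp (t * -a - v * t ^ 2 / 2)) ∂gaussianReal 0 v = 1 := by
  have he (a : ℝ) : Real.exp (t * -a - v * t ^ 2 / 2)
      = Real.exp (-(v * t ^ 2 / 2)) * Real.exp (-t * a) := by
    rw [← Real.exp_add]; congr 1; ring
  simp_rw [he]
  rw [← ofReal_integral_eq_lintegral_ofReal
    ((integrable_exp_mul_gaussianReal (-t)).const_mul _) (.of_forall fun a => by positivity),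
    integral_const_mul]
  have hmgf := mgf_gaussianReal (p := gaussianReal 0 v) (X := id)
    (by simp : _ = gaussianReal 0 v) (-t)
  simp only [mgf, id_eq] at hmgf
  rw [hmgf, ← Real.exp_add]
  simp

theorem lintegral_pruneEntry_off_diag {L : ℕ} {d₁ d₂ : Fin L → ℕ} (d Ψ : ℝ≥0) (e : Entry d₁ d₂)
    (he : (e.2.1 : ℕ) ≠ e.2.2) {h : ℝ → ENNReal} (hh : Measurable h) (a : ℝ) :
    ∫⁻ b, h (b - a) ∂pruneEntry d Ψ e a =
      ENNReal.ofReal (pruneProb d Ψ a) * h (-a) + ENNReal.ofReal (1 - pruneProb d Ψ a) * h 0 := by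
  have hm : Measurable fun b => h (b - a) := by fun_prop
  rw [pruneEntry, if_neg he, bernoulliMeasure_def, lintegral_add_measure, lintegral_smul_measure,
    lintegral_smul_measure, lintegral_dirac' _ hm, lintegral_dirac' _ hm]
  simp only [zero_sub, sub_self]
  congr 2
  · exact (Real.toNNReal_of_nonneg (pruneProb d Ψ a).2.1).symm
  · exact (Real.toNNReal_of_nonneg (sub_nonneg.2 (pruneProb d Ψ a).2.2)).symm

theorem lintegral_pruneErrorLaw_diag {L : ℕ} {d₁ d₂ : Fin L → ℕ} (d Ψ : ℝ≥0) (e : Entry d₁ d₂)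
    (he : (e.2.1 : ℕ) = e.2.2) {h : ℝ → ENNReal} (hh : Measurable h) :
    ∫⁻ x, h x ∂pruneErrorLaw d Ψ e = h 0 := by
  rw [lintegral_pruneErrorLaw d Ψ e hh]
  have (a : ℝ) : ∫⁻ b, h (b - a) ∂pruneEntry d Ψ e a = h 0 := by
    rw [pruneEntry, if_pos he, lintegral_dirac' _ (by fun_prop), sub_self]
  simp [this]

/-- A pruned weight `a` produces the error `-a`, and a kept one the error `0`: the law is a
reflected Gaussian part plus an atom at `0`. -/
theorem lintegral_pruneErrorLaw_off_diag {L : ℕ} {d₁ d₂ : Fin L → ℕ} {d Ψ : ℝ≥0} (hd : 0 < d)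
    (hΨ : 0 < Ψ) (e : Entry d₁ d₂) (he : (e.2.1 : ℕ) ≠ e.2.2) {h : ℝ → ENNReal}
    (hh : Measurable h) :
    ∫⁻ x, h x ∂pruneErrorLaw d Ψ e =
      ENNReal.ofReal (√(d / (d + 2))) * ∫⁻ a, h (-a) ∂gaussianReal 0 (Ψ * (d / (d + 2)))
        + (∫⁻ a, ENNReal.ofReal (1 - pruneProb d Ψ a) ∂gaussianReal 0 Ψ) * h 0 := by
  have hmp : Measurable fun a => (pruneProb d Ψ a : ℝ) := by
    unfold pruneProb
    fun_prop
  rw [lintegral_pruneErrorLaw d Ψ e hh]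
  simp_rw [lintegral_pruneEntry_off_diag d Ψ e he hh]
  rw [lintegral_add_left (by fun_prop), lintegral_pruneProb_mul hd hΨ (by fun_prop),
    lintegral_mul_const _ (by fun_prop)]

theorem ofReal_add_lintegral_one_sub_pruneProb {d Ψ : ℝ≥0} (hd : 0 < d) (hΨ : 0 < Ψ) :
    ENNReal.ofReal (√(d / (d + 2))) +
      ∫⁻ a, ENNReal.ofReal (1 - pruneProb d Ψ a) ∂gaussianReal 0 Ψ = 1 := by
  have hmp : Measurable fun a => (pruneProb d Ψ a : ℝ) := by
    unfold pruneProb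
    fun_prop
  have h := lintegral_pruneProb_mul hd hΨ (g := fun _ => 1) measurable_const
  simp only [mul_one, lintegral_one, measure_univ] at h
  rw [← h, ← lintegral_add_left (by fun_prop)]
  have (a : ℝ) : ENNReal.ofReal (pruneProb d Ψ a) + ENNReal.ofReal (1 - pruneProb d Ψ a) = 1 := by
    rw [← ENNReal.ofReal_add (pruneProb d Ψ a).2.1 (sub_nonneg.2 (pruneProb d Ψ a).2.2)]
    simp
  simp [this]

/-- Off the diagonal, the Gaussian part contributes exactly its mass because `exp (t a - s t² / 2)`
has mean `1`. The atom at `0` is not penalised and also contributes its mass, so the total is `1`.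
-/
theorem lintegral_exp_pruneErrorLaw_le_one {L : ℕ} {d₁ d₂ : Fin L → ℕ} {d Ψ : ℝ≥0} (hd : 0 < d)
    (hΨ : 0 < Ψ) (e : Entry d₁ d₂) (t : ℝ) :
    ∫⁻ a, ENNReal.ofReal (Real.exp (t * a - (Ψ * (d / (d + 2)) : ℝ≥0) * t ^ 2 / 2 * nonzeroInd a))
      ∂pruneErrorLaw d Ψ e ≤ 1 := by
  have hm : Measurable fun a => ENNReal.ofReal
      (Real.exp (t * a - (Ψ * (d / (d + 2)) : ℝ≥0) * t ^ 2 / 2 * nonzeroInd a)) := by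
    have := measurable_nonzeroInd
    fun_prop
  by_cases he : (e.2.1 : ℕ) = e.2.2
  · rw [lintegral_pruneErrorLaw_diag d Ψ e he hm]
    simp [nonzeroInd]
  · rw [lintegral_pruneErrorLaw_off_diag hd hΨ e he hm]
    have hσ : Ψ * (d / (d + 2)) ≠ 0 := by positivity
    -- The Gaussian part has no atom, so the indicator in the penalty equals `1` almost everywhere.
    have := nullSingletonClass_gaussianReal (μ := 0) hσ
    have hae : ∀ᵐ a ∂gaussianReal 0 (Ψ * (d / (d + 2))), ENNReal.ofReal (Real.exp
        (t * -a - (Ψ * (d / (d + 2)) : ℝ≥0) * t ^ 2 / 2 * nonzeroInd (-a))) =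
        ENNReal.ofReal (Real.exp (t * -a - (Ψ * (d / (d + 2)) : ℝ≥0) * t ^ 2 / 2)) := by
      filter_upwards [Measure.ae_ne (gaussianReal 0 (Ψ * (d / (d + 2)))) 0] with a ha
      simp [nonzeroInd, ha]
    rw [lintegral_congr_ae hae, lintegral_exp_gaussianReal_eq_one]
    have h0 : nonzeroInd 0 = 0 := by simp [nonzeroInd]
    simp only [h0, mul_zero, sub_zero, Real.exp_zero, ENNReal.ofReal_one, mul_one]
    exact (ofReal_add_lintegral_one_sub_pruneProb hd hΨ).le

theorem pruneErrorLaw_real_ne_zero_le {L : ℕ} {d₁ d₂ : Fin L → ℕ} {d Ψ : ℝ≥0} (hd : 0 < d)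
    (hΨ : 0 < Ψ) (e : Entry d₁ d₂) :
    (pruneErrorLaw d Ψ e).real {0}ᶜ ≤ √(d / (d + 2)) := by
  have hs : MeasurableSet ({0}ᶜ : Set ℝ) := (measurableSet_singleton 0).compl
  refine ENNReal.toReal_le_of_le_ofReal (Real.sqrt_nonneg _) ?_
  rw [← lintegral_indicator_one hs]
  have hm : Measurable (Set.indicator ({0}ᶜ : Set ℝ) (1 : ℝ → ENNReal)) :=
    measurable_one.indicator hs
  by_cases he : (e.2.1 : ℕ) = e.2.2
  · rw [lintegral_pruneErrorLaw_diag d Ψ e he hm]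
    simp
  · rw [lintegral_pruneErrorLaw_off_diag hd hΨ e he hm]
    simp only [Set.mem_compl_iff, Set.mem_singleton_iff, not_true_eq_false, not_false_eq_true,
      Set.indicator_of_notMem, mul_zero, add_zero]
    refine mul_le_of_le_one_right' ?_
    calc _ ≤ ∫⁻ _a, 1 ∂gaussianReal 0 (Ψ * (d / (d + 2))) :=
          lintegral_mono fun a => Set.indicator_le_self' (fun _ _ => zero_le_one) _
      _ = 1 := by simp

/-! ### Comparison with `Γ` and conclusion. -/

/-- The powers `3/2` and `5/2` arise as `s p = Ψ r^(3/2)` and `(s τ)² = m n Ψ² r^(5/2)`. -/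
theorem three_mul_sqrt_le_layerGamma {d Ψ : ℝ} (hd : 0 < d) (hΨ : 0 < Ψ) (m n : ℕ) :
    3 * √(Ψ * (d / (d + 2)) * (n * √(d / (d + 2)) + m * √(d / (d + 2))
      + √(m * n * √(d / (d + 2))))) ≤ layerGamma 3 d Ψ m n := by
  unfold layerGamma
  set r : ℝ := d / (d + 2) with hr
  have hr0 : 0 < r := by positivity
  set q : ℝ := √r with hq
  have hq0 : 0 < q := Real.sqrt_pos.2 hr0
  have h32 : d ^ (3 / 2 : ℝ) / (d + 2) ^ (3 / 2 : ℝ) = r * q := by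
    rw [← Real.div_rpow hd.le (by positivity), ← hr, show (3 / 2 : ℝ) = 1 + 1 / 2 by norm_num,
      Real.rpow_add hr0, Real.rpow_one, ← Real.sqrt_eq_rpow]
  have h52 : d ^ (5 / 2 : ℝ) / (d + 2) ^ (5 / 2 : ℝ) = r ^ 2 * q := by
    rw [← Real.div_rpow hd.le (by positivity), ← hr, show (5 / 2 : ℝ) = 2 + 1 / 2 by norm_num,
      Real.rpow_add hr0, ← Real.sqrt_eq_rpow]
    norm_cast
  rw [show d ^ (3 / 2 : ℝ) * Ψ / (d + 2) ^ (3 / 2 : ℝ) = r * q * Ψ by rw [← h32]; ring,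
    show 3 * (m : ℝ) * n * d ^ (5 / 2 : ℝ) * Ψ ^ 2 / (d + 2) ^ (5 / 2 : ℝ)
      = 3 * (m * n) * (r ^ 2 * q) * Ψ ^ 2 by rw [← h52]; ring]
  have h4 (x : ℝ) (hx : 0 ≤ x) : x ^ (1 / 4 : ℝ) = √√x := by
    rw [Real.sqrt_eq_rpow, Real.sqrt_eq_rpow, ← Real.rpow_mul hx]
    norm_num
  rw [h4 _ (by positivity)]
  have a1 : √(Ψ * r * (n * q)) = √(r * q * Ψ) * √n := by
    rw [← Real.sqrt_mul (by positivity)]; congr 1; ring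
  have a2 : √(Ψ * r * (m * q)) = √(r * q * Ψ) * √m := by
    rw [← Real.sqrt_mul (by positivity)]; congr 1; ring
  -- The factor `3` under the fourth root is slack here.
  have a3 : √(Ψ * r * √(m * n * q)) ≤ √√(3 * (m * n) * (r ^ 2 * q) * Ψ ^ 2) := by
    refine Real.sqrt_le_sqrt (Real.le_sqrt_of_sq_le ?_)
    rw [mul_pow, Real.sq_sqrt (by positivity)]
    have : 0 ≤ (Ψ * r) ^ 2 * (m * n * q) := by positivity
    nlinarith
  have hadd (x y : ℝ) (hx : 0 ≤ x) (hy : 0 ≤ y) : √(x + y) ≤ √x + √y :=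
    Real.sqrt_le_iff.2 ⟨by positivity, by
      nlinarith [Real.sq_sqrt hx, Real.sq_sqrt hy, Real.sqrt_nonneg x, Real.sqrt_nonneg y,
        mul_nonneg (Real.sqrt_nonneg x) (Real.sqrt_nonneg y)]⟩
  rw [mul_add, mul_add]
  have b1 := hadd (Ψ * r * (n * q) + Ψ * r * (m * q)) (Ψ * r * √(m * n * q))
    (by positivity) (by positivity)
  have b2 := hadd (Ψ * r * (n * q)) (Ψ * r * (m * q)) (by positivity) (by positivity)
  linarith

theorem layerGamma_nonneg {C d Ψ : ℝ} (hC : 0 ≤ C) (hd : 0 ≤ d) (m n : ℕ) :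
    0 ≤ layerGamma C d Ψ m n := by
  unfold layerGamma
  positivity

theorem spectralNorm₂_eq_zero_of_isEmpty {m n : ℕ} [IsEmpty (Fin m × Fin n)]
    (M : Matrix (Fin m) (Fin n) ℝ) : spectralNorm₂ M = 0 :=
  le_antisymm (spectralNorm₂_le_of_bilin_le M le_rfl fun x y _ _ => by simp)
    (spectralNorm₂_nonneg M)

/-- Markov's inequality in terms of the probability that a random variable is small. -/
theorem one_sub_one_div_le_measureReal {Ω : Type*} [MeasurableSpace Ω] {μ : Measure Ω}
    [IsProbabilityMeasure μ] {f : Ω → ℝ} (hf : Measurable f) {G ε : ℝ} (hG : 0 < G) (hε : 0 < ε)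
    (h : ∫⁻ ω, ENNReal.ofReal (f ω) ∂μ ≤ ENNReal.ofReal G) :
    1 - 1 / ε ≤ μ.real {ω | f ω ≤ ε * G} := by
  have hεG : 0 < ε * G := by positivity
  have hms : MeasurableSet {ω | f ω ≤ ε * G} := measurableSet_le hf measurable_const
  have h1 : μ {ω | f ω ≤ ε * G}ᶜ ≤ ENNReal.ofReal (1 / ε) := by
    calc μ {ω | f ω ≤ ε * G}ᶜ ≤ μ {ω | ENNReal.ofReal (ε * G) ≤ ENNReal.ofReal (f ω)} := by
          refine measure_mono fun ω hω => ENNReal.ofReal_le_ofReal ?_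
          simp only [Set.mem_compl_iff, Set.mem_ofPred_eq, not_le] at hω
          exact hω.le
      _ ≤ (∫⁻ ω, ENNReal.ofReal (f ω) ∂μ) / ENNReal.ofReal (ε * G) :=
          meas_ge_le_lintegral_div hf.ennreal_ofReal.aemeasurable (by simpa using hεG)
            ENNReal.ofReal_ne_top
      _ ≤ ENNReal.ofReal G / ENNReal.ofReal (ε * G) := by gcongr
      _ = ENNReal.ofReal (1 / ε) := by
          rw [← ENNReal.ofReal_div_of_pos hεG]
          congr 1
          field_simp
  have h2 : μ.real {ω | f ω ≤ ε * G}ᶜ ≤ 1 / ε :=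
    ENNReal.toReal_le_of_le_ofReal (by positivity) h1
  rw [probReal_compl_eq_one_sub hms] at h2
  linarith

theorem mainTheorem4 :
    ∃ C : ℝ, 0 < C ∧
      ∀ (L : ℕ) (d₁ d₂ : Fin L → ℕ) (d Ψ : ℝ≥0), 0 < d → 0 < Ψ →
      ∀ (Ω : Type*) [MeasurableSpace Ω] (P : Measure Ω) [IsProbabilityMeasure P]
        (A Ahat : Ω → Model d₁ d₂),
        -- every weight is a centred Gaussian of variance `Ψ`
        (∀ e, HasLaw (fun ω => A ω e) (gaussianReal 0 Ψ) P) →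
        -- the weights within each layer are independent
        (∀ l : Fin L, iIndepFun (fun (p : Fin (d₁ l) × Fin (d₂ l)) ω => A ω ⟨l, p⟩) P) →
        -- the pruned model is the output of the pruning algorithm run on `A`
        HasLaw (fun ω => (A ω, Ahat ω)) ((P.map A).compProd (mbp d₁ d₂ d Ψ)) P →
      ∀ (l : Fin L) (ε : ℝ), 0 < ε →
        1 - 1 / ε ≤ P.real {ω | spectralNorm₂ ((Ahat ω).layer l - (A ω).layer l)
          ≤ ε * layerGamma C d Ψ (d₁ l) (d₂ l)} := by
  refine ⟨3, by norm_num, ?_⟩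
  intro L d₁ d₂ d Ψ hd hΨ Ω _ P _ A Ahat hA hind hJ l ε hε
  have hd' : (0 : ℝ) < d := by exact_mod_cast hd
  have hΨ' : (0 : ℝ) < Ψ := by exact_mod_cast hΨ
  -- An empty layer is treated apart: the mean bound divides by `τ`, and `Γ` may vanish, which
  -- Markov's inequality does not allow.
  rcases isEmpty_or_nonempty (Fin (d₁ l) × Fin (d₂ l)) with hempty | ⟨⟨i₀, j₀⟩⟩
  · have hG := layerGamma_nonneg (Ψ := Ψ) (by norm_num : (0 : ℝ) ≤ 3) hd'.le (d₁ l) (d₂ l)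
    have huniv : {ω | spectralNorm₂ ((Ahat ω).layer l - (A ω).layer l)
        ≤ ε * layerGamma 3 d Ψ (d₁ l) (d₂ l)} = Set.univ := by
      refine Set.eq_univ_of_forall fun ω => ?_
      rw [Set.mem_ofPred_eq, spectralNorm₂_eq_zero_of_isEmpty]
      positivity
    rw [huniv, probReal_univ]
    have : 0 < 1 / ε := by positivity
    linarith
  have hm : 0 < d₁ l := i₀.pos
  have hn : 0 < d₂ l := j₀.pos
  have hlaw := hasLaw_layer_sub hA l (hind l) hJ
  have hr : (0 : ℝ) < √(d / (d + 2)) := Real.sqrt_pos.2 (by positivity)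
  have hbound := lintegral_spectralNorm₂_pi_le hm hn
    (fun p => pruneErrorLaw d Ψ (⟨l, p⟩ : Entry d₁ d₂))
    (s := (Ψ * (d / (d + 2)) : ℝ≥0)) (by positivity) hr
    (fun p t => lintegral_exp_pruneErrorLaw_le_one hd hΨ _ t)
    (fun p => pruneErrorLaw_real_ne_zero_le hd hΨ _)
  have hΓ := three_mul_sqrt_le_layerGamma hd' hΨ' (d₁ l) (d₂ l)
  have hm' : (0 : ℝ) < d₁ l := by exact_mod_cast hm
  have hn' : (0 : ℝ) < d₂ l := by exact_mod_cast hn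
  have hpos : 0 < layerGamma 3 d Ψ (d₁ l) (d₂ l) := lt_of_lt_of_le (by positivity) hΓ
  push_cast at hbound
  have h := one_sub_one_div_le_measureReal measurable_spectralNorm₂ hpos hε
    (hbound.trans (ENNReal.ofReal_le_ofReal hΓ))
  rwa [← hlaw.measureReal_eq (measurableSet_le measurable_spectralNorm₂ measurable_const)] at h
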